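/- **Theorem (canonical connection of a 3-quasi-Sasakian manifold).** Conventions: for a 1-form $\eta$, $2\,d\eta(X,Y)=X(\eta(Y))-Y(\eta(X))-\eta([X,Y])$; for a field of endomorphisms $\phi$, $[\phi,\phi](X,Y)=\phi^2[X,Y]+[\phi X,\phi Y]-\phi[\phi X,Y]-\phi[X,\phi Y]$. Let $M$ be a smooth manifold of dimension $4n+3$ ($n\ge 0$) with a smooth Riemannian metric $g$ and, for $\alpha=1,2,3$, a smooth field of endomorphisms $\phi_\alpha$ of the tangent spaces, a smooth vector field $\xi_\alpha$ and a smooth 1-form $\eta_\alpha$. Suppose that $(M,\phi_\alpha,\xi_\alpha,\eta_\alpha,g)$ is a *3-quasi-Sasakian manifold*, that is: (a) (almost contact metric structures) for each $\alpha$: $\phi_\alpha^2=-I+\eta_\alpha\otimes\xi_\alpha$, $\eta_\alpha(\xi_\alpha)=1$, and $g(\phi_\alpha X,\phi_\alpha Y)=g(X,Y)-\eta_\alpha(X)\eta_\alpha(Y)$; (b) (almost 3-contact) for every even permutation $(\alpha,\beta,\gamma)$ of $\{1,2,3\}$: $\phi_\gamma=\phi_\alpha\phi_\beta-\eta_\beta\otimes\xi_\alpha=-\phi_\beta\phi_\alpha+\eta_\alpha\otimes\xi_\beta$,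 $\ \xi_\gamma=\phi_\alpha\xi_\beta=-\phi_\beta\xi_\alpha$, $\ \eta_\gamma=\eta_\alpha\circ\phi_\beta=-\eta_\beta\circ\phi_\alpha$; (c) (quasi-Sasakian) for each $\alpha$ the structure is normal, i.e. $[\phi_\alpha,\phi_\alpha]+2\,d\eta_\alpha\otimes\xi_\alpha=0$, and its fundamental 2-form $\Phi_\alpha(X,Y)=g(X,\phi_\alpha Y)$ is closed. Then there exists a unique smooth connection $\tilde\nabla$ on the tangent bundle of $M$ that is metric ($\tilde\nabla g=0$) and satisfies (i) $\tilde\nabla\eta_\alpha=0$ and $\tilde\nabla\xi_\alpha=0$ for each $\alpha\in\{1,2,3\}$; (ii) its torsion $\tilde T(X,Y)=\tilde\nabla_XY-\tilde\nabla_YX-[X,Y]$ is $\tilde T(X,Y)=2\sum_{\alpha=1}^{3}d\eta_\alpha(X,Y)\,\xi_\alpha$ for all vector fields $X,Y$. -/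

import Mathlib

open Bundle
open scoped Manifold ContDiff

noncomputable section

namespace ThreeQS

section Forms

variable {m : ℕ} {M : Type*} [TopologicalSpace M] [ChartedSpace (EuclideanSpace ℝ (Fin m)) M]
  [IsManifold (𝓡 m) ∞ M]

/-- A (not necessarily smooth) vector field on the manifold `M` of dimension `m`. -/
abbrev VField (m : ℕ) (M : Type*) [TopologicalSpace M]
    [ChartedSpace (EuclideanSpace ℝ (Fin m)) M] : Type _ :=
  Π x : M, TangentSpace (𝓡 m) x

/-- A (not necessarily smooth) `1`-form on `M`. -/
abbrev OneForm (m : ℕ) (M : Type*) [TopologicalSpace M]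
    [ChartedSpace (EuclideanSpace ℝ (Fin m)) M] : Type _ :=
  Π x : M, TangentSpace (𝓡 m) x →L[ℝ] ℝ

/-- A (not necessarily smooth) field of endomorphisms of the tangent spaces of `M`. -/
abbrev EndoField (m : ℕ) (M : Type*) [TopologicalSpace M]
    [ChartedSpace (EuclideanSpace ℝ (Fin m)) M] : Type _ :=
  Π x : M, TangentSpace (𝓡 m) x →L[ℝ] TangentSpace (𝓡 m) x

/-- The vector field `X` is differentiable at the point `x`. -/
def VField.DiffAt (X : VField m M) (x : M) : Prop :=
  MDifferentiableAt (𝓡 m) (𝓡 m).tangent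
    (fun y ↦ (TotalSpace.mk' (EuclideanSpace ℝ (Fin m)) y (X y) :
      TangentBundle (𝓡 m) M)) x

/-- The Lie bracket `[X, Y]` of vector fields. -/
def bracket (X Y : VField m M) : VField m M :=
  VectorField.mlieBracket (𝓡 m) X Y

/-- The derivative `X(f)` of the function `f` along the vector field `X`. -/
def lieDeriv (X : VField m M) (f : M → ℝ) (x : M) : ℝ :=
  mvfderiv (𝓡 m) f x (X x)

/-- The exterior derivative of a `1`-form on vector fields, with the normalization usual in
contact geometry, `2 dη(X, Y) = X(η(Y)) - Y(η(X)) - η([X, Y])`. For a differentiable form, the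
value at `x` depends only on `X x` and `Y x` as long as `X`, `Y` are differentiable at `x`. -/
def dOne (η : OneForm m M) (X Y : VField m M) (x : M) : ℝ :=
  (lieDeriv X (fun y ↦ η y (Y y)) x - lieDeriv Y (fun y ↦ η y (X y)) x
    - η x (bracket X Y x)) / 2

/-- The exterior derivative of a `2`-form, given as an alternating function of two vector fields,
with the matching normalization
`3 dΦ(X, Y, Z) = X(Φ(Y, Z)) + Y(Φ(Z, X)) + Z(Φ(X, Y)) - Φ([X, Y], Z) - Φ([Y, Z], X) - Φ([Z, X], Y)`.
-/
def dTwo (Φ : VField m M → VField m M → M → ℝ) (X Y Z : VField m M) (x : M) : ℝ :=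
  (lieDeriv X (Φ Y Z) x + lieDeriv Y (Φ Z X) x + lieDeriv Z (Φ X Y) x
    - Φ (bracket X Y) Z x - Φ (bracket Y Z) X x - Φ (bracket Z X) Y x) / 3

/-- The field of endomorphisms `φ` applied to the vector field `X`. -/
def EndoField.app (φ : EndoField m M) (X : VField m M) : VField m M :=
  fun x ↦ φ x (X x)

/-- The Nijenhuis torsion
`[φ, φ](X, Y) = φ²[X, Y] + [φX, φY] - φ[φX, Y] - φ[X, φY]`. -/
def nijenhuis (φ : EndoField m M) (X Y : VField m M) : VField m M := fun x ↦
  φ x (φ x (bracket X Y x)) + bracket (φ.app X) (φ.app Y) x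
    - φ x (bracket (φ.app X) Y x) - φ x (bracket X (φ.app Y) x)

end Forms

section Structures

variable (m : ℕ) (M : Type*) [TopologicalSpace M] [ChartedSpace (EuclideanSpace ℝ (Fin m)) M]
  [IsManifold (𝓡 m) ∞ M]

/-- A (smooth) almost contact structure `(φ, ξ, η)` on the manifold `M`:
`φ² = -I + η ⊗ ξ` and `η(ξ) = 1`. -/
structure AlmostContact where
  φ : EndoField m M
  ξ : VField m M
  η : OneForm m M
  smooth_φ : ContMDiff (𝓡 m)
    ((𝓡 m).prod 𝓘(ℝ, EuclideanSpace ℝ (Fin m) →L[ℝ] EuclideanSpace ℝ (Fin m))) ∞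
    (fun x ↦ TotalSpace.mk' (EuclideanSpace ℝ (Fin m) →L[ℝ] EuclideanSpace ℝ (Fin m))
      (E := fun x : M ↦ TangentSpace (𝓡 m) x →L[ℝ] TangentSpace (𝓡 m) x) x (φ x))
  smooth_ξ : ContMDiff (𝓡 m) (𝓡 m).tangent ∞
    (fun x ↦ (TotalSpace.mk' (EuclideanSpace ℝ (Fin m)) x (ξ x) : TangentBundle (𝓡 m) M))
  smooth_η : ContMDiff (𝓡 m) ((𝓡 m).prod 𝓘(ℝ, EuclideanSpace ℝ (Fin m) →L[ℝ] ℝ)) ∞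
    (fun x ↦ TotalSpace.mk' (EuclideanSpace ℝ (Fin m) →L[ℝ] ℝ)
      (E := fun x : M ↦ TangentSpace (𝓡 m) x →L[ℝ] Trivial M ℝ x) x (η x))
  φ_sq : ∀ (x : M) (v : TangentSpace (𝓡 m) x), φ x (φ x v) = -v + η x v • ξ x
  η_ξ : ∀ x : M, η x (ξ x) = 1

variable {m M}

namespace AlmostContact

/-- The structure is normal: `N⁽¹⁾ = [φ, φ] + 2 dη ⊗ ξ` vanishes identically. -/
def IsNormal (c : AlmostContact m M) : Prop :=
  ∀ (x : M) (X Y : VField m M), X.DiffAt x → Y.DiffAt x →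
    nijenhuis c.φ X Y x + (2 * dOne c.η X Y x) • c.ξ x = 0

variable [RiemannianBundle (fun x : M ↦ TangentSpace (𝓡 m) x)]

/-- The Riemannian metric `g` is compatible with the structure:
`g(φX, φY) = g(X, Y) - η(X) η(Y)`. -/
def IsCompatible (c : AlmostContact m M) : Prop :=
  ∀ (x : M) (v w : TangentSpace (𝓡 m) x),
    inner ℝ (c.φ x v) (c.φ x w) = inner ℝ v w - c.η x v * c.η x w

/-- The fundamental `2`-form `Φ(X, Y) = g(X, φY)`. -/
def fundamentalForm (c : AlmostContact m M) (X Y : VField m M) (x : M) : ℝ :=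
  inner ℝ (X x) (c.φ x (Y x))

/-- An almost contact metric structure is quasi-Sasakian if it is normal and its fundamental
`2`-form is closed. -/
structure IsQuasiSasakian (c : AlmostContact m M) : Prop where
  compatible : c.IsCompatible
  normal : c.IsNormal
  closed : ∀ (x : M) (X Y Z : VField m M), X.DiffAt x → Y.DiffAt x → Z.DiffAt x →
    dTwo c.fundamentalForm X Y Z x = 0

end AlmostContact

/-- Three almost contact structures, indexed by `Fin 3`, form an almost `3`-contact structure.
The even permutations of the three indices are the cyclic ones `(α, α + 1, α + 2)`. -/
structure IsAlmostThreeContact (c : Fin 3 → AlmostContact m M) : Prop where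
  φ_eq : ∀ (α : Fin 3) (x : M) (v : TangentSpace (𝓡 m) x),
    (c (α + 2)).φ x v
      = (c α).φ x ((c (α + 1)).φ x v) - (c (α + 1)).η x v • (c α).ξ x
  φ_eq' : ∀ (α : Fin 3) (x : M) (v : TangentSpace (𝓡 m) x),
    (c (α + 2)).φ x v
      = -(c (α + 1)).φ x ((c α).φ x v) + (c α).η x v • (c (α + 1)).ξ x
  ξ_eq : ∀ (α : Fin 3) (x : M), (c (α + 2)).ξ x = (c α).φ x ((c (α + 1)).ξ x)
  ξ_eq' : ∀ (α : Fin 3) (x : M), (c (α + 2)).ξ x = -(c (α + 1)).φ x ((c α).ξ x)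
  η_eq : ∀ (α : Fin 3) (x : M) (v : TangentSpace (𝓡 m) x),
    (c (α + 2)).η x v = (c α).η x ((c (α + 1)).φ x v)
  η_eq' : ∀ (α : Fin 3) (x : M) (v : TangentSpace (𝓡 m) x),
    (c (α + 2)).η x v = -(c (α + 1)).η x ((c α).φ x v)

end Structures

section Main

variable {m : ℕ} {M : Type*} [TopologicalSpace M]
  [ChartedSpace (EuclideanSpace ℝ (Fin m)) M] [IsManifold (𝓡 m) ∞ M]
  [RiemannianBundle (fun x : M ↦ TangentSpace (𝓡 m) x)]

/-- `(M, φ_α, ξ_α, η_α, g)` is a `3`-quasi-Sasakian manifold: an almost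
`3`-contact metric manifold each of whose three structures is quasi-Sasakian. The metric `g` is
the given inner product on the tangent spaces. -/
structure IsThreeQuasiSasakian (c : Fin 3 → AlmostContact m M) : Prop where
  almostThreeContact : IsAlmostThreeContact c
  quasiSasakian : ∀ α : Fin 3, (c α).IsQuasiSasakian

variable [IsContMDiffRiemannianBundle (𝓡 m) ∞ (EuclideanSpace ℝ (Fin m))
  (fun x : M ↦ TangentSpace (𝓡 m) x)]

/-- A connection on (the tangent bundle of) `M`, possibly not smooth. The vector
`∇_X Y` at `x` is `cov Y x (X x)`. -/
abbrev Connection (m : ℕ) (M : Type*) [TopologicalSpace M]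
    [ChartedSpace (EuclideanSpace ℝ (Fin m)) M]
    [IsManifold (𝓡 m) ∞ M] : Type _ :=
  CovariantDerivative (𝓡 m) (EuclideanSpace ℝ (Fin m))
    (fun x : M ↦ TangentSpace (𝓡 m) x)

/-- The `1`-form `η` is parallel: `(∇_X η)(Y) = X(η(Y)) - η(∇_X Y)` vanishes for all `X`, `Y`. -/
def IsParallelForm (cov : Connection m M) (η : OneForm m M) : Prop :=
  ∀ (x : M) (X Y : VField m M), Y.DiffAt x →
    lieDeriv X (fun y ↦ η y (Y y)) x - η x (cov Y x (X x)) = 0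

/-- The vector field `ξ` is parallel: `∇_X ξ = 0` for all `X`. -/
def IsParallelField (cov : Connection m M) (ξ : VField m M) : Prop :=
  ∀ (x : M) (X : VField m M), cov ξ x (X x) = 0

set_option synthInstance.maxHeartbeats 400000 in
/-- `cov` is a smooth metric connection for which all `η_α`, `ξ_α` are parallel and whose torsion
is `T(X, Y) = 2 ∑ dη_α(X, Y) ξ_α`. -/
structure IsCanonicalConnection (c : Fin 3 → AlmostContact m M)
    (cov : Connection m M) : Prop where
  smooth : CovariantDerivative.ContMDiffCovariantDerivative cov ∞
  metric : cov.IsMetricCompatible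
  parallel_η : ∀ α : Fin 3, IsParallelForm cov (c α).η
  parallel_ξ : ∀ α : Fin 3, IsParallelField cov (c α).ξ
  torsion_eq : ∀ (x : M) (X Y : VField m M), X.DiffAt x → Y.DiffAt x →
    CovariantDerivative.torsion cov x (X x) (Y x)
      = (2 : ℝ) • ∑ α : Fin 3, dOne (c α).η X Y x • (c α).ξ x

end Main

end ThreeQS

end

/-! On a Riemannian manifold every skew, vector-valued tensor `T` is the torsion of exactly one
metric connection, given by a Koszul formula with torsion terms. Uniqueness is therefore immediate
once the torsion is prescribed. For existence, take `T = 2 ∑ dη_α ⊗ ξ_α`; it remains to see that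
each `ξ_β` is parallel. Then `η_β = g(ξ_β, ·)` is parallel too, because the connection is metric.

Two facts make the Koszul expression of `g(∇_X ξ_β, Z)` vanish. First, each `ξ_β` is Killing
(`lieDeriv_ξ_inner`): normality makes `η` and `φ` invariant along `ξ`, closedness makes `Φ`
invariant, and `g = Φ(φ·, ·) + η ⊗ η`. This removes the metric derivative and the brackets with
`ξ_β`, while the terms forming `2 dη_β(X, Z)` cancel against `η_β(T(X, Z))`. What is left is, up to
a factor, the symmetrization of `∑ dη_α(ξ_β, X) η_α(Z)`.

Second, `[ξ_α, ξ_β] = f ξ_γ` for all even permutations, with a single function `f`: closedness of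
the `Φ_α` gives the direction, the Killing property the common factor. Since `2 dη_α(ξ_β, ·) =
g([ξ_β, ξ_α], ·)`, that sum is skew in `X, Z` (`sum_dOne_ξ_mul_η`), so its symmetrization is zero.
-/

noncomputable section

/-! ### Smoothness criteria for sections and homomorphisms of vector bundles -/

section Smoothness

variable {E : Type*} [NormedAddCommGroup E] [NormedSpace ℝ E]
  {H : Type*} [TopologicalSpace H] {I : ModelWithCorners ℝ E H}
  {M : Type*} [TopologicalSpace M] [ChartedSpace H M] {k : ℕ∞ω} {x : M}

theorem contMDiffAt_matrix_det {ι : Type*} [Fintype ι] [DecidableEq ι] {A : M → Matrix ι ι ℝ}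
    (hA : ∀ i j, ContMDiffAt I 𝓘(ℝ) k (fun y ↦ A y i j) x) :
    ContMDiffAt I 𝓘(ℝ) k (fun y ↦ (A y).det) x := by
  simp only [Matrix.det_apply']
  exact ContMDiffAt.sum fun σ _ ↦ contMDiffAt_const.mul (contMDiffAt_finsetProd fun i _ ↦ hA _ _)

theorem contMDiffAt_mvfderiv_apply [IsManifold I ∞ M] {f : M → ℝ}
    {X : Π y : M, TangentSpace I y}
    (hf : ContMDiffAt I 𝓘(ℝ) ∞ f x)
    (hX : ContMDiffAt I I.tangent ∞ (fun y ↦ (⟨y, X y⟩ : TangentBundle I M)) x) :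
    ContMDiffAt I 𝓘(ℝ) ∞ (fun y ↦ mvfderiv I f y (X y)) x := by
  have h := ContMDiffAt.clm_apply_of_inCoordinates (hf.mfderiv_const (m := ∞) (by simp)) hX hf
  rw [contMDiffAt_totalSpace] at h
  refine h.2.congr_of_eventuallyEq (.of_forall fun y ↦ ?_)
  simp [mvfderiv]
  rfl

variable {F₁ : Type*} [NormedAddCommGroup F₁] [NormedSpace ℝ F₁] [FiniteDimensional ℝ F₁]
  {E₁ : M → Type*} [TopologicalSpace (TotalSpace F₁ E₁)]
  [∀ x, AddCommGroup (E₁ x)] [∀ x, Module ℝ (E₁ x)] [∀ x : M, TopologicalSpace (E₁ x)]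
  [FiberBundle F₁ E₁] [VectorBundle ℝ F₁ E₁] [ContMDiffVectorBundle k F₁ E₁ I]
  {F₂ : Type*} [NormedAddCommGroup F₂] [NormedSpace ℝ F₂]
  {E₂ : M → Type*} [TopologicalSpace (TotalSpace F₂ E₂)]
  [∀ x, AddCommGroup (E₂ x)] [∀ x, Module ℝ (E₂ x)] [∀ x : M, TopologicalSpace (E₂ x)]
  [FiberBundle F₂ E₂] [VectorBundle ℝ F₂ E₂]
  [∀ x, IsTopologicalAddGroup (E₂ x)] [∀ x, ContinuousSMul ℝ (E₂ x)]

/-- A field of linear maps is `C^k` at a point if it maps `C^k` sections to `C^k` sections. -/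
theorem contMDiffAt_hom_of_apply {φ : Π y : M, E₁ y →L[ℝ] E₂ y}
    (h : ∀ σ : Π y : M, E₁ y,
      ContMDiffAt I (I.prod 𝓘(ℝ, F₁)) k (fun y ↦ TotalSpace.mk' F₁ y (σ y)) x →
      ContMDiffAt I (I.prod 𝓘(ℝ, F₂)) k (fun y ↦ TotalSpace.mk' F₂ y (φ y (σ y))) x) :
    ContMDiffAt I (I.prod 𝓘(ℝ, F₁ →L[ℝ] F₂)) k
      (fun y ↦ TotalSpace.mk' (F₁ →L[ℝ] F₂) (E := fun y : M ↦ E₁ y →L[ℝ] E₂ y) y (φ y)) x := by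
  rw [contMDiffAt_hom_bundle]
  refine ⟨contMDiffAt_id, ?_⟩
  let b := Module.finBasis ℝ F₁
  let c : Fin (Module.finrank ℝ F₁) → F₁ →L[ℝ] ℝ := fun i ↦
    LinearMap.toContinuousLinearMap (b.coord i)
  -- Finite dimension of `F₁` reduces smoothness of `A` to smoothness of its finitely many values `A
  -- (b i)`, which are tested on a local frame.
  have hsum : ∀ A : F₁ →L[ℝ] F₂, A = ∑ i,
      ContinuousLinearMap.smulRightL ℝ F₁ F₂ (c i) (A (b i)) := by
    intro A
    ext v
    conv_lhs => rw [← b.sum_repr v]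
    simp only [map_sum, map_smul, sum_apply,
      ContinuousLinearMap.smulRightL_apply_apply, ContinuousLinearMap.smulRight_apply, c]
    rfl
  have happ : ∀ i, ContMDiffAt I 𝓘(ℝ, F₂) k (fun y ↦
      ContinuousLinearMap.inCoordinates F₁ E₁ F₂ E₂ x y x y (φ y) (b i)) x := by
    intro i
    have hx : x ∈ (trivializationAt F₁ E₁ x).baseSet :=
      FiberBundle.mem_baseSet_trivializationAt' x
    have hs := h _ (contMDiffAt_localFrame_of_mem (I := I) k (trivializationAt F₁ E₁ x) b i hx)
    rw [contMDiffAt_totalSpace] at hs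
    refine hs.2.congr_of_eventuallyEq ?_
    filter_upwards [(trivializationAt F₁ E₁ x).open_baseSet.mem_nhds hx,
      (trivializationAt F₂ E₂ x).open_baseSet.mem_nhds
        (FiberBundle.mem_baseSet_trivializationAt' x)] with y hy hy'
    rw [ContinuousLinearMap.inCoordinates_eq hy hy',
      Trivialization.localFrame_apply_of_mem_baseSet (hx := hy)]
    simp [Trivialization.basisAt]
  have : (fun y ↦ ContinuousLinearMap.inCoordinates F₁ E₁ F₂ E₂ x y x y (φ y)) = fun y ↦ ∑ i,
      ContinuousLinearMap.smulRightL ℝ F₁ F₂ (c i)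
        (ContinuousLinearMap.inCoordinates F₁ E₁ F₂ E₂ x y x y (φ y) (b i)) :=
    funext fun y ↦ hsum _
  change ContMDiffAt I _ k
    (fun y ↦ ContinuousLinearMap.inCoordinates F₁ E₁ F₂ E₂ x y x y (φ y)) x
  rw [this]
  exact ContMDiffAt.sum fun i _ ↦ (ContinuousLinearMap.contMDiff _).contMDiffAt.comp x (happ i)

/-- A section of a Riemannian vector bundle is `C^k` at a point if its inner products with
`C^k` sections are. -/
theorem contMDiffAt_section_of_inner {F : Type*} [NormedAddCommGroup F] [NormedSpace ℝ F]
    [FiniteDimensional ℝ F]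
    {V : M → Type*} [TopologicalSpace (TotalSpace F V)]
    [∀ x, NormedAddCommGroup (V x)] [∀ x, InnerProductSpace ℝ (V x)]
    [FiberBundle F V] [VectorBundle ℝ F V] [ContMDiffVectorBundle k F V I]
    [IsContMDiffRiemannianBundle I k F V] {σ : Π y : M, V y}
    (h : ∀ τ : Π y : M, V y,
      ContMDiffAt I (I.prod 𝓘(ℝ, F)) k (fun y ↦ TotalSpace.mk' F y (τ y)) x →
      ContMDiffAt I 𝓘(ℝ) k (fun y ↦ inner ℝ (σ y) (τ y)) x) :
    ContMDiffAt I (I.prod 𝓘(ℝ, F)) k (fun y ↦ TotalSpace.mk' F y (σ y)) x := by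
  classical
  let e := trivializationAt F V x
  let b := Module.finBasis ℝ F
  have hx : x ∈ e.baseSet := FiberBundle.mem_baseSet_trivializationAt' x
  have hs := fun i ↦ contMDiffAt_localFrame_of_mem (I := I) k e b i hx
  let G : M → Matrix _ _ ℝ := fun y ↦ Matrix.gram ℝ (fun i ↦ e.localFrame b i y)
  have hG : ∀ i j, ContMDiffAt I 𝓘(ℝ) k (fun y ↦ G y i j) x := fun i j ↦
    (hs i).inner_bundle (hs j)
  have hF := e.isLocalFrameOn_localFrame_baseSet I k b
  have hdet : ∀ y ∈ e.baseSet, (G y).det ≠ 0 := fun y hy ↦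
    Matrix.det_gram_ne_zero_iff_linearIndependent.2 (hF.linearIndependent hy)
  let w : M → _ → ℝ := fun y i ↦ inner ℝ (σ y) (e.localFrame b i y)
  -- The coefficients of `σ` in the frame solve a linear system with the Gram matrix; Cramer's rule
  -- writes them as quotients of determinants with smooth entries.
  have key : ∀ᶠ y in nhds x, σ y =
      ∑ i, (((G y).det)⁻¹ * (G y).cramer (w y) i) • e.localFrame b i y := by
    filter_upwards [e.open_baseSet.mem_nhds hx] with y hy
    refine InnerProductSpace.ext_inner_right_basis (hF.toBasisAt hy) fun j ↦ ?_
    have hw := congrFun (Matrix.mulVec_cramer (G y) (w y)) j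
    simp only [Matrix.mulVec, dotProduct, Pi.smul_apply, smul_eq_mul] at hw
    simp only [IsLocalFrameOn.toBasisAt_coe, sum_inner, real_inner_smul_left]
    rw [← mul_right_inj' (hdet y hy), ← hw, Finset.mul_sum]
    refine Finset.sum_congr rfl fun i _ ↦ ?_
    have := hdet y hy
    field_simp
    simp [G, Matrix.gram_apply, real_inner_comm, mul_comm]
  have hc : ∀ i, ContMDiffAt I 𝓘(ℝ) k
      (fun y ↦ ((G y).det)⁻¹ * (G y).cramer (w y) i) x := by
    intro i
    refine ((contMDiffAt_matrix_det hG).inv₀ (hdet x hx)).mul ?_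
    simp only [Matrix.cramer_apply]
    refine contMDiffAt_matrix_det fun a c ↦ ?_
    by_cases hci : c = i
    · subst hci; simpa using h _ (hs a)
    · simpa [hci] using hG a c
  refine (ContMDiffAt.sum_section fun i (_ : i ∈ Finset.univ) ↦
    (hc i).smul_section (hs i)).congr_of_eventuallyEq ?_
  filter_upwards [key] with y hy
  simp [hy]

end Smoothness

/-! ### The metric connection with prescribed skew torsion -/

section MetricConnection

open VectorField

/-- The endomorphism representing a bilinear form on a finite-dimensional inner product space. -/
theorem exists_inner_apply_eq {V : Type*} [NormedAddCommGroup V] [InnerProductSpace ℝ V]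
    [FiniteDimensional ℝ V] (B : V →L[ℝ] V →L[ℝ] ℝ) :
    ∃ L : V →L[ℝ] V, ∀ v w, inner ℝ (L v) w = B v w := by
  have : CompleteSpace V := FiniteDimensional.complete ℝ V
  refine ⟨LinearMap.toContinuousLinearMap
    { toFun := fun v ↦ (InnerProductSpace.toDual ℝ V).symm (B v)
      map_add' := fun v w ↦ by simp
      map_smul' := fun r v ↦ by simp }, fun v w ↦ by simp⟩

theorem finiteDimensional_tangentSpace {E : Type*} [NormedAddCommGroup E] [NormedSpace ℝ E]
    [FiniteDimensional ℝ E] {H : Type*} [TopologicalSpace H] {I : ModelWithCorners ℝ E H}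
    {M : Type*} [TopologicalSpace M] [ChartedSpace H M] (x : M) :
    FiniteDimensional ℝ (TangentSpace I x) :=
  inferInstanceAs (FiniteDimensional ℝ E)

variable {E : Type*} [NormedAddCommGroup E] [NormedSpace ℝ E]
  {H : Type*} [TopologicalSpace H] {I : ModelWithCorners ℝ E H}
  {M : Type*} [TopologicalSpace M] [ChartedSpace H M]
  [RiemannianBundle (fun x : M ↦ TangentSpace I x)]

/-- The Koszul expression: twice the inner product `⟨∇_X Y, Z⟩` for the metric connection `∇` with
torsion `T`. -/
def koszul (T : Π x : M, TangentSpace I x →L[ℝ] TangentSpace I x →L[ℝ] TangentSpace I x)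
    (X Y Z : Π x : M, TangentSpace I x) (x : M) : ℝ :=
  mvfderiv I (fun y ↦ inner ℝ (Y y) (Z y)) x (X x)
    + mvfderiv I (fun y ↦ inner ℝ (X y) (Z y)) x (Y x)
    - mvfderiv I (fun y ↦ inner ℝ (X y) (Y y)) x (Z x)
    + inner ℝ (mlieBracket I X Y x + T x (X x) (Y x)) (Z x)
    - inner ℝ (mlieBracket I X Z x + T x (X x) (Z x)) (Y x)
    - inner ℝ (mlieBracket I Y Z x + T x (Y x) (Z x)) (X x)

variable {T : Π x : M, TangentSpace I x →L[ℝ] TangentSpace I x →L[ℝ] TangentSpace I x}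
  {X Y Z : Π x : M, TangentSpace I x} {x : M}

/-- This identity is metric compatibility of the connection defined by `koszul`; the skew part in
`X, Y`, treated next, yields its torsion. -/
theorem koszul_add_koszul_swap_right (hT : ∀ x v w, T x v w = -T x w v) :
    koszul T X Y Z x + koszul T X Z Y x =
      2 * mvfderiv I (fun y ↦ inner ℝ (Y y) (Z y)) x (X x) := by
  simp only [koszul, fun y ↦ real_inner_comm (Y y) (Z y), hT x (Z x) (Y x),
    mlieBracket_swap_apply (V := Z) (W := Y), inner_add_left, inner_neg_left]
  ring

theorem koszul_sub_koszul_swap_left (hT : ∀ x v w, T x v w = -T x w v) :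
    koszul T X Y Z x - koszul T Y X Z x =
      2 * inner ℝ (mlieBracket I X Y x + T x (X x) (Y x)) (Z x) := by
  simp only [koszul, fun y ↦ real_inner_comm (X y) (Y y), hT x (Y x) (X x),
    mlieBracket_swap_apply (V := Y) (W := X), inner_add_left, inner_neg_left]
  ring

variable [IsManifold I ∞ M]

theorem clm_ext_inner_vectorField {L L' : TangentSpace I x →L[ℝ] TangentSpace I x}
    (h : ∀ X Z : Π x : M, TangentSpace I x, MDiffAt (T% X) x → MDiffAt (T% Z) x →
      2 * inner ℝ (L (X x)) (Z x) = 2 * inner ℝ (L' (X x)) (Z x)) : L = L' := by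
  ext v
  refine ext_inner_right ℝ fun w ↦ ?_
  simpa using h (FiberBundle.extend E v) (FiberBundle.extend E w)
    (FiberBundle.mdifferentiableAt_extend ..) (FiberBundle.mdifferentiableAt_extend ..)

variable [IsContMDiffRiemannianBundle I ∞ E (fun x : M ↦ TangentSpace I x)]

theorem MDifferentiableAt.inner_vectorField (hX : MDiffAt (T% X) x) (hY : MDiffAt (T% Y) x) :
    MDiffAt (fun y ↦ inner ℝ (X y) (Y y)) x :=
  MDifferentiableAt.inner_bundle (F := E) (E := fun x : M ↦ TangentSpace I x) hX hY

theorem ContMDiffAt.inner_vectorField (hX : CMDiffAt ∞ (T% X) x) (hY : CMDiffAt ∞ (T% Y) x) :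
    CMDiffAt ∞ (fun y ↦ inner ℝ (X y) (Y y)) x :=
  ContMDiffAt.inner_bundle (F := E) (E := fun x : M ↦ TangentSpace I x) hX hY

theorem mvfderiv_inner_smul_left {f : M → ℝ} (hf : MDiffAt f x) (hX : MDiffAt (T% X) x)
    (hY : MDiffAt (T% Y) x) (v : TangentSpace I x) :
    mvfderiv I (fun y ↦ inner ℝ ((f • X) y) (Y y)) x v =
      mvfderiv I f x v * inner ℝ (X x) (Y x)
        + f x * mvfderiv I (fun y ↦ inner ℝ (X y) (Y y)) x v := by
  simp only [Pi.smul_apply', real_inner_smul_left]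
  refine (congr($(mvfderiv_mul hf (hX.inner_vectorField hY)) v)).trans ?_
  simp only [add_apply, smul_apply, smul_eq_mul]
  ring

theorem mvfderiv_inner_add_left (hX : MDiffAt (T% X) x) (hZ : MDiffAt (T% Z) x)
    (hY : MDiffAt (T% Y) x) (v : TangentSpace I x) :
    mvfderiv I (fun y ↦ inner ℝ ((X + Z) y) (Y y)) x v =
      mvfderiv I (fun y ↦ inner ℝ (X y) (Y y)) x v
        + mvfderiv I (fun y ↦ inner ℝ (Z y) (Y y)) x v := by
  simp only [Pi.add_apply, inner_add_left]
  exact congr($(mvfderiv_add (hX.inner_vectorField hY) (hZ.inner_vectorField hY)) v)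

theorem mvfderiv_inner_smul_right {f : M → ℝ} (hf : MDiffAt f x) (hX : MDiffAt (T% X) x)
    (hY : MDiffAt (T% Y) x) (v : TangentSpace I x) :
    mvfderiv I (fun y ↦ inner ℝ (X y) ((f • Y) y)) x v =
      mvfderiv I f x v * inner ℝ (X x) (Y x)
        + f x * mvfderiv I (fun y ↦ inner ℝ (X y) (Y y)) x v := by
  simpa only [real_inner_comm] using mvfderiv_inner_smul_left hf hY hX v

theorem mvfderiv_inner_add_right (hX : MDiffAt (T% X) x) (hY : MDiffAt (T% Y) x)
    (hZ : MDiffAt (T% Z) x) (v : TangentSpace I x) :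
    mvfderiv I (fun y ↦ inner ℝ (X y) ((Y + Z) y)) x v =
      mvfderiv I (fun y ↦ inner ℝ (X y) (Y y)) x v
        + mvfderiv I (fun y ↦ inner ℝ (X y) (Z y)) x v := by
  simpa only [real_inner_comm] using mvfderiv_inner_add_left hY hZ hX v

variable [FiniteDimensional ℝ E]

/-- The derivatives of `f` coming from the metric terms cancel those coming from the brackets. The
same happens in the slot `Z`; in the slot `Y` a term `2 X(f) g(Y, Z)` survives, which is the Leibniz
rule. -/
theorem tensorialAt_koszul_left (hY : MDiffAt (T% Y) x) (hZ : MDiffAt (T% Z) x) :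
    TensorialAt I E (koszul T · Y Z x) x where
  smul {f X} hf hX := by
    simp only [koszul, mlieBracket_smul_left hf hX, mvfderiv_inner_smul_left hf hX hY,
      mvfderiv_inner_smul_left hf hX hZ]
    simp only [Pi.smul_apply', map_smul, inner_add_left, real_inner_smul_left,
      real_inner_smul_right, smul_eq_mul, smul_apply]
    ring
  add {X X'} hX hX' := by
    simp only [koszul, mlieBracket_add_left hX hX', mvfderiv_inner_add_left hX hX' hY,
      mvfderiv_inner_add_left hX hX' hZ]
    simp only [Pi.add_apply, map_add, inner_add_left,
      inner_add_right, add_apply]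
    ring

theorem tensorialAt_koszul_right (hX : MDiffAt (T% X) x) (hY : MDiffAt (T% Y) x) :
    TensorialAt I E (koszul T X Y · x) x where
  smul {f Z} hf hZ := by
    simp only [koszul, mlieBracket_smul_right hf hZ, mvfderiv_inner_smul_right hf hX hZ,
      mvfderiv_inner_smul_right hf hY hZ]
    simp only [Pi.smul_apply', map_smul, inner_add_left, real_inner_smul_left,
      real_inner_smul_right, smul_eq_mul, real_inner_comm]
    ring
  add {Z Z'} hZ hZ' := by
    simp only [koszul, mlieBracket_add_right hZ hZ', mvfderiv_inner_add_right hX hZ hZ',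
      mvfderiv_inner_add_right hY hZ hZ']
    simp only [Pi.add_apply, map_add, inner_add_left, inner_add_right]
    ring

theorem koszul_add_middle {Y' : Π x : M, TangentSpace I x} (hX : MDiffAt (T% X) x)
    (hY : MDiffAt (T% Y) x) (hY' : MDiffAt (T% Y') x) (hZ : MDiffAt (T% Z) x) :
    koszul T X (Y + Y') Z x = koszul T X Y Z x + koszul T X Y' Z x := by
  simp only [koszul, mlieBracket_add_right hY hY', mlieBracket_add_left hY hY',
    mvfderiv_inner_add_right hX hY hY', mvfderiv_inner_add_left hY hY' hZ]
  simp only [Pi.add_apply, map_add, add_apply, inner_add_left, inner_add_right]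
  ring

theorem koszul_smul_middle {f : M → ℝ} (hf : MDiffAt f x) (hX : MDiffAt (T% X) x)
    (hY : MDiffAt (T% Y) x) (hZ : MDiffAt (T% Z) x) :
    koszul T X (f • Y) Z x =
      f x * koszul T X Y Z x + 2 * mvfderiv I f x (X x) * inner ℝ (Y x) (Z x) := by
  simp only [koszul, mlieBracket_smul_right hf hY, mlieBracket_smul_left hf hY,
    mvfderiv_inner_smul_right hf hX hY, mvfderiv_inner_smul_left hf hY hZ]
  simp only [Pi.smul_apply', map_smul, smul_apply, inner_add_left, real_inner_smul_left,
      real_inner_smul_right, smul_eq_mul, real_inner_comm]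
  ring

theorem exists_inner_eq_koszul
    (T : Π x : M, TangentSpace I x →L[ℝ] TangentSpace I x →L[ℝ] TangentSpace I x)
    (Y : Π x : M, TangentSpace I x) (x : M) :
    ∃ L : TangentSpace I x →L[ℝ] TangentSpace I x,
      MDiffAt (T% Y) x → ∀ X Z : Π x : M, TangentSpace I x, MDiffAt (T% X) x → MDiffAt (T% Z) x →
        2 * inner ℝ (L (X x)) (Z x) = koszul T X Y Z x := by
  by_cases hY : MDiffAt (T% Y) x
  · have := finiteDimensional_tangentSpace (I := I) x
    obtain ⟨L, hL⟩ := exists_inner_apply_eq ((1 / 2 : ℝ) • TensorialAt.mkHom₂ (koszul T · Y · x) x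
      (fun Z hZ ↦ tensorialAt_koszul_left hY hZ) (fun X hX ↦ tensorialAt_koszul_right hX hY))
    refine ⟨L, fun _ X Z hX hZ ↦ ?_⟩
    rw [hL, smul_apply, smul_apply, TensorialAt.mkHom₂_apply _ _ hX hZ, smul_eq_mul]
    ring
  · exact ⟨0, fun h ↦ absurd h hY⟩

/-- `∇ Y` for the metric connection `∇` with torsion `T`. -/
def metricCovDeriv (T : Π x : M, TangentSpace I x →L[ℝ] TangentSpace I x →L[ℝ] TangentSpace I x)
    (Y : Π x : M, TangentSpace I x) (x : M) :
    TangentSpace I x →L[ℝ] TangentSpace I x :=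
  (exists_inner_eq_koszul T Y x).choose

theorem inner_metricCovDeriv (hX : MDiffAt (T% X) x) (hY : MDiffAt (T% Y) x)
    (hZ : MDiffAt (T% Z) x) :
    2 * inner ℝ (metricCovDeriv T Y x (X x)) (Z x) = koszul T X Y Z x :=
  (exists_inner_eq_koszul T Y x).choose_spec hY X Z hX hZ

/-- The metric connection with prescribed torsion `T`. -/
def metricConnection (T : Π x : M, TangentSpace I x →L[ℝ] TangentSpace I x →L[ℝ] TangentSpace I x) :
    CovariantDerivative I E (fun x : M ↦ TangentSpace I x) where
  toFun := metricCovDeriv T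
  isCovariantDerivativeOnUniv :=
    { add := fun {Y Y' x} hY hY' _ ↦ clm_ext_inner_vectorField fun X Z hX hZ ↦ by
        have h := mdifferentiableAt_add_section hY hY'
        rw [inner_metricCovDeriv hX h hZ, koszul_add_middle hX hY hY' hZ, add_apply,
          inner_add_left, mul_add, inner_metricCovDeriv hX hY hZ, inner_metricCovDeriv hX hY' hZ]
      leibniz := fun {Y f x} hY hf _ ↦ clm_ext_inner_vectorField fun X Z hX hZ ↦ by
        have h := hf.smul_section hY
        rw [inner_metricCovDeriv hX h hZ, koszul_smul_middle hf hX hY hZ, add_apply, smul_apply,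
          ContinuousLinearMap.smulRight_apply, inner_add_left, real_inner_smul_left,
          real_inner_smul_left, ← inner_metricCovDeriv hX hY hZ]
        ring }

theorem metricConnection_apply (Y : Π x : M, TangentSpace I x) :
    metricConnection T Y = metricCovDeriv T Y := rfl

theorem metricConnection_torsion (hT : ∀ x v w, T x v w = -T x w v) :
    (metricConnection T).torsion = T := by
  funext x
  ext v w
  refine ext_inner_right ℝ fun u ↦ ?_
  have key : ∀ X Y Z : Π x : M, TangentSpace I x, MDiffAt (T% X) x → MDiffAt (T% Y) x →
      MDiffAt (T% Z) x → inner ℝ ((metricConnection T).torsion x (X x) (Y x)) (Z x) =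
        inner ℝ (T x (X x) (Y x)) (Z x) := by
    intro X Y Z hX hY hZ
    have h₁ := inner_metricCovDeriv (T := T) hX hY hZ
    have h₂ := inner_metricCovDeriv (T := T) hY hX hZ
    have h₃ := koszul_sub_koszul_swap_left (x := x) (X := X) (Y := Y) (Z := Z) hT
    rw [CovariantDerivative.torsion_apply _ hX hY]
    simp only [metricConnection_apply, inner_sub_left]
    rw [inner_add_left] at h₃
    linarith
  simpa using key (FiberBundle.extend E v) (FiberBundle.extend E w) (FiberBundle.extend E u)
    (FiberBundle.mdifferentiableAt_extend ..) (FiberBundle.mdifferentiableAt_extend ..)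
    (FiberBundle.mdifferentiableAt_extend ..)

theorem contMDiffAt_koszul
    (hT : ∀ X Y : Π x : M, TangentSpace I x, CMDiffAt ∞ (T% X) x → CMDiffAt ∞ (T% Y) x →
      CMDiffAt ∞ (T% (fun y ↦ T y (X y) (Y y))) x)
    (hX : CMDiffAt ∞ (T% X) x) (hY : CMDiffAt ∞ (T% Y) x) (hZ : CMDiffAt ∞ (T% Z) x) :
    CMDiffAt ∞ (koszul T X Y Z) x := by
  have : IsManifold I (minSmoothness ℝ 2) M := by simpa using inferInstanceAs (IsManifold I 2 M)
  have : IsManifold I (((⊤ : ℕ∞) : ℕ∞ω) + 1) M := inferInstanceAs (IsManifold I ∞ M)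
  have hL : ∀ X Y Z : Π x : M, TangentSpace I x, CMDiffAt ∞ (T% X) x → CMDiffAt ∞ (T% Y) x →
      CMDiffAt ∞ (T% Z) x →
      CMDiffAt ∞ (fun y ↦ inner ℝ (mlieBracket I X Y y + T y (X y) (Y y)) (Z y)) x :=
    fun X Y Z hX hY hZ ↦ ContMDiffAt.inner_vectorField
      ((ContMDiffAt.mlieBracket_vectorField (m := ⊤) (n := ⊤) hX hY (by simp)).add_section
        (hT X Y hX hY)) hZ
  exact (((((contMDiffAt_mvfderiv_apply (hY.inner_vectorField hZ) hX).add
    (contMDiffAt_mvfderiv_apply (hX.inner_vectorField hZ) hY)).sub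
    (contMDiffAt_mvfderiv_apply (hX.inner_vectorField hY) hZ)).add (hL X Y Z hX hY hZ)).sub
    (hL X Z Y hX hZ hY)).sub (hL Y Z X hY hZ hX)

theorem metricConnection_contMDiff
    (hT : ∀ (x : M) (X Y : Π x : M, TangentSpace I x), CMDiffAt ∞ (T% X) x → CMDiffAt ∞ (T% Y) x →
      CMDiffAt ∞ (T% (fun y ↦ T y (X y) (Y y))) x) :
    CovariantDerivative.ContMDiffCovariantDerivative (metricConnection T) ∞ where
  contMDiff :=
    { contMDiff := fun {Y} hY x hx ↦ by
        replace hY : ∀ y, CMDiffAt ∞ (T% Y) y := fun y ↦ (hY y trivial).contMDiffAt Filter.univ_mem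
        refine ContMDiffAt.contMDiffWithinAt ?_
        refine contMDiffAt_hom_of_apply (E₁ := fun x : M ↦ TangentSpace I x) fun X hX ↦ ?_
        refine contMDiffAt_section_of_inner (V := fun x : M ↦ TangentSpace I x) fun Z hZ ↦ ?_
        -- The Koszul identity is needed on a whole neighbourhood. Smoothness at `x` spreads to
        -- nearby points only at finite order, and order 1 is enough.
        have hev : ∀ X : Π x : M, TangentSpace I x, CMDiffAt ∞ (T% X) x →
            ∀ᶠ y in nhds x, MDiffAt (T% X) y := fun X hX ↦
          ((contMDiffAt_iff_contMDiffAt_nhds (n := 1) (by simp)).1 (hX.of_le (by simp))).mono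
            fun y hy ↦ hy.mdifferentiableAt one_ne_zero
        refine (contMDiffAt_const (c := (1 / 2 : ℝ)).mul
          (contMDiffAt_koszul (hT x) hX (hY x) hZ)).congr_of_eventuallyEq ?_
        filter_upwards [hev X hX, hev Z hZ] with y hXy hZy
        have := inner_metricCovDeriv (T := T) hXy ((hY y).mdifferentiableAt (by simp)) hZy
        simp only [Pi.mul_apply, ← this, metricConnection_apply]
        ring }

end MetricConnection

/-! ### Metric compatibility, and uniqueness for given torsion -/

section Euclidean

open VectorField
variable {m : ℕ} {M : Type*} [TopologicalSpace M]
  [ChartedSpace (EuclideanSpace ℝ (Fin m)) M] [IsManifold (𝓡 m) ∞ M]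
  [RiemannianBundle (fun x : M ↦ TangentSpace (𝓡 m) x)]
  [IsContMDiffRiemannianBundle (𝓡 m) ∞ (EuclideanSpace ℝ (Fin m))
    (fun x : M ↦ TangentSpace (𝓡 m) x)]
  {T : Π x : M, TangentSpace (𝓡 m) x →L[ℝ] TangentSpace (𝓡 m) x →L[ℝ] TangentSpace (𝓡 m) x}
  {X Y Z : ThreeQS.VField m M} {x : M}

set_option synthInstance.maxHeartbeats 400000 in
theorem metricConnection_isMetricCompatible (hT : ∀ x v w, T x v w = -T x w v) :
    (metricConnection T).IsMetricCompatible := by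
  refine (CovariantDerivative.isMetricCompatible_iff _).2 fun {x X Y Z} hX hY hZ ↦ ?_
  have h₁ := inner_metricCovDeriv (T := T) hX hY hZ
  have h₂ := inner_metricCovDeriv (T := T) hX hZ hY
  rw [real_inner_comm] at h₂
  have h₃ := koszul_add_koszul_swap_right (x := x) (X := X) (Y := Y) (Z := Z) hT
  simp only [metricConnection_apply]
  linarith

set_option synthInstance.maxHeartbeats 400000 in
-- Expanding the three metric derivatives by compatibility and the torsion by its definition,
-- everything but `∇_X Y` cancels. This gives uniqueness.
theorem two_mul_inner_eq_koszul {cov : ThreeQS.Connection m M}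
    (hcov : cov.IsMetricCompatible) (hX : X.DiffAt x) (hY : Y.DiffAt x) (hZ : Z.DiffAt x) :
    2 * inner ℝ (cov Y x (X x)) (Z x) = koszul cov.torsion X Y Z x := by
  have h₁ := hcov.mvfderiv_inner_eq X hY hZ
  have h₂ := hcov.mvfderiv_inner_eq Y hX hZ
  have h₃ := hcov.mvfderiv_inner_eq Z hX hY
  simp only [koszul, h₁, h₂, h₃, cov.torsion_apply hX hY, cov.torsion_apply hX hZ,
    cov.torsion_apply hY hZ]
  simp only [inner_add_left, inner_sub_left, real_inner_comm]
  ring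

end Euclidean

namespace ThreeQS

/-! ### Calculus of Lie derivatives and `dη` -/

section Fields

variable {m : ℕ} {M : Type*} [TopologicalSpace M]
  [ChartedSpace (EuclideanSpace ℝ (Fin m)) M] {x : M}

theorem bracket_swap (X Y : VField m M) (x : M) : bracket X Y x = -bracket Y X x :=
  VectorField.mlieBracket_swap_apply

theorem lieDeriv_const (X : VField m M) (a : ℝ) (x : M) : lieDeriv X (fun _ ↦ a) x = 0 := by
  simp [lieDeriv, mvfderiv_const]

theorem lieDeriv_add (X : VField m M) {f g : M → ℝ} (hf : MDifferentiableAt (𝓡 m) 𝓘(ℝ) f x)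
    (hg : MDifferentiableAt (𝓡 m) 𝓘(ℝ) g x) :
    lieDeriv X (fun y ↦ f y + g y) x = lieDeriv X f x + lieDeriv X g x :=
  congr($(mvfderiv_add hf hg) (X x))

theorem lieDeriv_mul (X : VField m M) {f g : M → ℝ} (hf : MDifferentiableAt (𝓡 m) 𝓘(ℝ) f x)
    (hg : MDifferentiableAt (𝓡 m) 𝓘(ℝ) g x) :
    lieDeriv X (fun y ↦ f y * g y) x = f x * lieDeriv X g x + g x * lieDeriv X f x :=
  congr($(mvfderiv_mul hf hg) (X x))

theorem dOne_swap (η : OneForm m M) (X Y : VField m M) (x : M) : dOne η X Y x = -dOne η Y X x := by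
  simp only [dOne, bracket_swap X Y, map_neg]
  ring

end Fields

/-! ### A single structure: pointwise algebra, tensoriality of `dη`, Killing Reeb field -/

namespace AlmostContact

section Pointwise

variable {m : ℕ} {M : Type*} [TopologicalSpace M]
  [ChartedSpace (EuclideanSpace ℝ (Fin m)) M] [IsManifold (𝓡 m) ∞ M]
  (c : AlmostContact m M) (x : M)

/-- Since `φ²ξ = 0`, the formula for `φ²` at `φξ` gives `φξ = aξ` with `a = η(φξ)`. Applying `φ`
once more gives `aφξ = 0`, so either factor being zero suffices. -/
theorem φ_ξ : c.φ x (c.ξ x) = 0 := by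
  have h₁ : c.φ x (c.φ x (c.ξ x)) = 0 := by simp [c.φ_sq, c.η_ξ]
  have h₂ := c.φ_sq x (c.φ x (c.ξ x))
  rw [h₁, map_zero] at h₂
  have h₃ : c.φ x (c.ξ x) = c.η x (c.φ x (c.ξ x)) • c.ξ x := by
    rw [eq_comm, ← sub_eq_zero, sub_eq_neg_add]
    exact h₂.symm
  have h₄ := congrArg (c.φ x) h₃
  rw [map_smul, h₁] at h₄
  rcases smul_eq_zero.1 h₄.symm with h | h
  · rw [h₃, h, zero_smul]
  · exact h

/-- Compare `φ²(φv)` with `φ(φ²v)`: the difference is `η(φv) ξ`. -/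
theorem η_φ (v : TangentSpace (𝓡 m) x) : c.η x (c.φ x v) = 0 := by
  have h₁ := c.φ_sq x (c.φ x v)
  rw [c.φ_sq x v, map_add, map_neg, map_smul, c.φ_ξ, smul_zero, add_zero, eq_comm] at h₁
  have h₂ := congrArg (c.η x) (add_eq_left.1 h₁)
  simpa [c.η_ξ] using h₂

variable [RiemannianBundle (fun x : M ↦ TangentSpace (𝓡 m) x)]
variable {c x}

theorem IsCompatible.inner_ξ (h : c.IsCompatible) (v : TangentSpace (𝓡 m) x) :
    inner ℝ (c.ξ x) v = c.η x v := by
  have := h x (c.ξ x) v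
  rw [c.φ_ξ, inner_zero_left, c.η_ξ] at this
  linarith

theorem IsCompatible.inner_φ (h : c.IsCompatible) (v w : TangentSpace (𝓡 m) x) :
    inner ℝ (c.φ x v) w = -inner ℝ v (c.φ x w) := by
  have h₁ := h x v (c.φ x w)
  rw [c.φ_sq, inner_add_right, inner_neg_right, inner_smul_right, real_inner_comm (c.ξ x),
    h.inner_ξ, c.η_φ, c.η_φ] at h₁
  linarith

end Pointwise

section Smooth
variable {m : ℕ} {M : Type*} [TopologicalSpace M]
  [ChartedSpace (EuclideanSpace ℝ (Fin m)) M] [IsManifold (𝓡 m) ∞ M]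
  (c : AlmostContact m M) {x : M} {X Y : VField m M}

theorem diffAt_ξ : c.ξ.DiffAt x := (c.smooth_ξ x).mdifferentiableAt (by simp)

theorem diffAt_app (hX : X.DiffAt x) : VField.DiffAt (c.φ.app X) x :=
  ((c.smooth_φ x).mdifferentiableAt (by simp)).clm_bundle_apply
    (F₁ := EuclideanSpace ℝ (Fin m)) (E₁ := fun x : M ↦ TangentSpace (𝓡 m) x) hX

theorem contMDiffAt_η_apply (hX : ContMDiffAt (𝓡 m) (𝓡 m).tangent ∞
    (fun y ↦ (⟨y, X y⟩ : TangentBundle (𝓡 m) M)) x) :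
    ContMDiffAt (𝓡 m) 𝓘(ℝ) ∞ (fun y ↦ c.η y (X y)) x :=
  (contMDiffAt_totalSpace.1 (ContMDiffAt.clm_bundle_apply
    (F₁ := EuclideanSpace ℝ (Fin m)) (E₁ := fun x : M ↦ TangentSpace (𝓡 m) x)
    (E₂ := Bundle.Trivial M ℝ) (c.smooth_η x) hX)).2

theorem mdifferentiableAt_η_apply (hX : X.DiffAt x) :
    MDifferentiableAt (𝓡 m) 𝓘(ℝ) (fun y ↦ c.η y (X y)) x :=
  ((mdifferentiableAt_totalSpace _ _).1 (MDifferentiableAt.clm_bundle_apply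
    (F₁ := EuclideanSpace ℝ (Fin m)) (E₁ := fun x : M ↦ TangentSpace (𝓡 m) x)
    (E₂ := Bundle.Trivial M ℝ) ((c.smooth_η x).mdifferentiableAt (by simp)) hX)).2

theorem tensorialAt_dOne_right (X : VField m M) :
    TensorialAt (𝓡 m) (EuclideanSpace ℝ (Fin m)) (dOne c.η X · x) x where
  smul {f Y} hf hY := by
    have h₁ : lieDeriv X (fun y ↦ c.η y ((f • Y) y)) x
        = f x * lieDeriv X (fun y ↦ c.η y (Y y)) x + c.η x (Y x) * lieDeriv X f x := by
      simpa using lieDeriv_mul X hf (c.mdifferentiableAt_η_apply hY)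
    have h₂ : bracket X (f • Y) x = lieDeriv X f x • Y x + f x • bracket X Y x :=
      VectorField.mlieBracket_smul_right hf hY
    simp only [dOne, h₁, h₂, map_add, map_smul, smul_eq_mul]
    simp only [lieDeriv, Pi.smul_apply', map_smul, smul_eq_mul]
    ring
  add {Y Y'} hY hY' := by
    have h₁ : lieDeriv X (fun y ↦ c.η y ((Y + Y') y)) x
        = lieDeriv X (fun y ↦ c.η y (Y y)) x + lieDeriv X (fun y ↦ c.η y (Y' y)) x := by
      simpa using lieDeriv_add X (c.mdifferentiableAt_η_apply hY) (c.mdifferentiableAt_η_apply hY')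
    have h₂ : bracket X (Y + Y') x = bracket X Y x + bracket X Y' x :=
      VectorField.mlieBracket_add_right hY hY'
    simp only [dOne, h₁, h₂, map_add]
    simp only [lieDeriv, Pi.add_apply, map_add]
    ring

theorem tensorialAt_dOne_left (Y : VField m M) :
    TensorialAt (𝓡 m) (EuclideanSpace ℝ (Fin m)) (dOne c.η · Y x) x where
  smul hf hX := by
    simp only [dOne_swap c.η _ Y, (c.tensorialAt_dOne_right Y).smul hf hX, smul_neg]
  add hX hX' := by
    simp only [dOne_swap c.η _ Y, (c.tensorialAt_dOne_right Y).add hX hX', neg_add]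

theorem contMDiffAt_dOne
    (hX : ContMDiffAt (𝓡 m) (𝓡 m).tangent ∞ (fun y ↦ (⟨y, X y⟩ : TangentBundle (𝓡 m) M)) x)
    (hY : ContMDiffAt (𝓡 m) (𝓡 m).tangent ∞ (fun y ↦ (⟨y, Y y⟩ : TangentBundle (𝓡 m) M)) x) :
    ContMDiffAt (𝓡 m) 𝓘(ℝ) ∞ (dOne c.η X Y) x := by
  have : IsManifold (𝓡 m) (minSmoothness ℝ 2) M := by
    simpa using inferInstanceAs (IsManifold (𝓡 m) 2 M)
  have : IsManifold (𝓡 m) (((⊤ : ℕ∞) : ℕ∞ω) + 1) M := inferInstanceAs (IsManifold (𝓡 m) ∞ M)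
  have h : ContMDiffAt (𝓡 m) 𝓘(ℝ) ∞ (fun y ↦ c.η y (bracket X Y y)) x := c.contMDiffAt_η_apply
    (ContMDiffAt.mlieBracket_vectorField (m := ⊤) (n := ⊤) hX hY (by simp))
  exact (((contMDiffAt_mvfderiv_apply (c.contMDiffAt_η_apply hY) hX).sub
    (contMDiffAt_mvfderiv_apply (c.contMDiffAt_η_apply hX) hY)).sub h).div_const 2

end Smooth

section QuasiSasakian

variable {m : ℕ} {M : Type*} [TopologicalSpace M]
  [ChartedSpace (EuclideanSpace ℝ (Fin m)) M] [IsManifold (𝓡 m) ∞ M]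
  {c : AlmostContact m M} {x : M} {X Y Z : VField m M}

theorem dOne_ξ_left :
    dOne c.η c.ξ Y x = (lieDeriv c.ξ (fun y ↦ c.η y (Y y)) x - c.η x (bracket c.ξ Y x)) / 2 := by
  simp only [dOne, c.η_ξ, lieDeriv_const, sub_zero]

theorem IsNormal.bracket_ξ (h : c.IsNormal) (hY : Y.DiffAt x) :
    c.φ x (c.φ x (bracket c.ξ Y x)) - c.φ x (bracket c.ξ (c.φ.app Y) x)
      + (2 * dOne c.η c.ξ Y x) • c.ξ x = 0 := by
  have h₀ : c.φ.app c.ξ = (0 : VField m M) := funext fun y ↦ c.φ_ξ y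
  have := h x c.ξ Y c.diffAt_ξ hY
  simpa [nijenhuis, h₀, bracket] using this

/-- The `ξ`-component of normality: `η` kills the image of `φ`. Equivalently, `η` is invariant along
`ξ`. -/
theorem IsNormal.dOne_ξ (h : c.IsNormal) (hY : Y.DiffAt x) : dOne c.η c.ξ Y x = 0 := by
  have := congrArg (c.η x) (h.bracket_ξ hY)
  simpa [c.η_φ, c.η_ξ] using this

theorem IsNormal.lieDeriv_ξ_η (h : c.IsNormal) (hY : Y.DiffAt x) :
    lieDeriv c.ξ (fun y ↦ c.η y (Y y)) x = c.η x (bracket c.ξ Y x) := by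
  have := h.dOne_ξ hY
  rw [dOne_ξ_left] at this
  linarith

/-- Invariance of `φ` along `ξ`. Normality gives it only after applying `φ`; the component lost
there, along `ξ`, vanishes because `η` is invariant and `η ∘ φ = 0`. -/
theorem IsNormal.bracket_ξ_app (h : c.IsNormal) (hY : Y.DiffAt x) :
    bracket c.ξ (c.φ.app Y) x = c.φ x (bracket c.ξ Y x) := by
  have h₁ := h.bracket_ξ hY
  rw [h.dOne_ξ hY, mul_zero, zero_smul, add_zero, ← map_sub] at h₁
  have h₂ := congrArg (c.φ x) h₁
  have h₃ : c.η x (bracket c.ξ (c.φ.app Y) x) = 0 := by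
    rw [← h.lieDeriv_ξ_η (c.diffAt_app hY)]
    simp only [EndoField.app, c.η_φ, lieDeriv_const]
  rw [c.φ_sq, map_zero, map_sub, c.η_φ, h₃, sub_zero, zero_smul, add_zero, neg_eq_zero,
    sub_eq_zero] at h₂
  exact h₂.symm

variable [RiemannianBundle (fun x : M ↦ TangentSpace (𝓡 m) x)]

theorem IsCompatible.fundamentalForm_ξ_left (h : c.IsCompatible) (Y : VField m M) :
    c.fundamentalForm c.ξ Y = fun _ ↦ 0 := by
  funext y
  simp [fundamentalForm, h.inner_ξ, c.η_φ]

theorem fundamentalForm_ξ_right (Y : VField m M) :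
    c.fundamentalForm Y c.ξ = fun _ ↦ 0 := by
  funext y
  simp [fundamentalForm, c.φ_ξ]

theorem IsCompatible.fundamentalForm_swap (h : c.IsCompatible) (X Y : VField m M) :
    c.fundamentalForm X Y x = -c.fundamentalForm Y X x := by
  rw [fundamentalForm, fundamentalForm, real_inner_comm, h.inner_φ]

/-- Cartan's formula: `Φ` is closed and its contraction with `ξ` is zero, so `Φ` is invariant along
`ξ`. -/
theorem IsQuasiSasakian.lieDeriv_ξ_fundamentalForm (h : c.IsQuasiSasakian) (hY : Y.DiffAt x)
    (hZ : Z.DiffAt x) :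
    lieDeriv c.ξ (c.fundamentalForm Y Z) x =
      c.fundamentalForm (bracket c.ξ Y) Z x + c.fundamentalForm Y (bracket c.ξ Z) x := by
  have h₁ := h.closed x c.ξ Y Z c.diffAt_ξ hY hZ
  rw [dTwo, h.compatible.fundamentalForm_ξ_left, fundamentalForm_ξ_right,
    fundamentalForm_ξ_right, lieDeriv_const, lieDeriv_const,
    h.compatible.fundamentalForm_swap (bracket Z c.ξ) Y] at h₁
  have h₂ : c.fundamentalForm Y (bracket Z c.ξ) x = -c.fundamentalForm Y (bracket c.ξ Z) x := by
    simp only [fundamentalForm, bracket_swap Z c.ξ, map_neg, inner_neg_right]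
  linarith

variable [IsContMDiffRiemannianBundle (𝓡 m) ∞ (EuclideanSpace ℝ (Fin m))
    (fun x : M ↦ TangentSpace (𝓡 m) x)]

/-- The Reeb vector field of a quasi-Sasakian structure is Killing. -/
theorem IsQuasiSasakian.lieDeriv_ξ_inner (h : c.IsQuasiSasakian) (hY : Y.DiffAt x)
    (hZ : Z.DiffAt x) :
    lieDeriv c.ξ (fun y ↦ inner ℝ (Y y) (Z y)) x =
      inner ℝ (bracket c.ξ Y x) (Z x) + inner ℝ (Y x) (bracket c.ξ Z x) := by
  have hφY := c.diffAt_app hY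
  have hφZ := c.diffAt_app hZ
  have hηY := c.mdifferentiableAt_η_apply hY
  have hηZ := c.mdifferentiableAt_η_apply hZ
  have h₁ := h.lieDeriv_ξ_fundamentalForm hφY hZ
  -- The metric is `Φ(φ·, ·) + η ⊗ η`, built from tensors invariant along `ξ`.
  have h₂ : (fun y ↦ inner ℝ (Y y) (Z y)) =
      fun y ↦ c.fundamentalForm (c.φ.app Y) Z y + c.η y (Y y) * c.η y (Z y) := by
    funext y
    rw [fundamentalForm, EndoField.app, h.compatible y (Y y) (Z y)]
    ring
  have h₃ : MDifferentiableAt (𝓡 m) 𝓘(ℝ) (c.fundamentalForm (c.φ.app Y) Z) x :=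
    MDifferentiableAt.inner_vectorField hφY hφZ
  have h₄ : MDifferentiableAt (𝓡 m) 𝓘(ℝ) (fun y ↦ c.η y (Y y) * c.η y (Z y)) x := hηY.mul hηZ
  rw [h₂, lieDeriv_add _ h₃ h₄, h₁, lieDeriv_mul _ hηY hηZ,
    h.normal.lieDeriv_ξ_η hY, h.normal.lieDeriv_ξ_η hZ]
  simp only [fundamentalForm, h.normal.bracket_ξ_app hY, EndoField.app, h.compatible x]
  ring

end QuasiSasakian

end AlmostContact

/-! ### Brackets of the three Reeb fields -/

section ThreeStructures

variable {m : ℕ} {M : Type*} [TopologicalSpace M]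
  [ChartedSpace (EuclideanSpace ℝ (Fin m)) M] [IsManifold (𝓡 m) ∞ M]
  {c : Fin 3 → AlmostContact m M} {x : M} {X Y Z : VField m M}

theorem IsAlmostThreeContact.φ_ξ_succ (h : IsAlmostThreeContact c) (α : Fin 3) (x : M) :
    (c α).φ x ((c (α + 1)).ξ x) = (c (α + 2)).ξ x := (h.ξ_eq α x).symm

theorem IsAlmostThreeContact.φ_ξ_add_two (h : IsAlmostThreeContact c) (α : Fin 3) (x : M) :
    (c α).φ x ((c (α + 2)).ξ x) = -(c (α + 1)).ξ x := by
  have := h.ξ_eq' (α + 2) x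
  rw [(by decide : ∀ α : Fin 3, α + 2 + 2 = α + 1) α,
    (by decide : ∀ α : Fin 3, α + 2 + 1 = α) α] at this
  rw [this, neg_neg]

theorem IsAlmostThreeContact.η_ξ (h : IsAlmostThreeContact c) (α β : Fin 3) (x : M) :
    (c α).η x ((c β).ξ x) = if α = β then 1 else 0 := by
  have h₁ : ∀ α, (c α).η x ((c (α + 2)).ξ x) = 0 := fun α ↦ by
    rw [h.ξ_eq, AlmostContact.η_φ]
  have h₂ : ∀ α, (c α).η x ((c (α + 1)).ξ x) = 0 := fun α ↦ by
    have := h.φ_ξ_add_two α x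
    rw [eq_comm, neg_eq_iff_eq_neg] at this
    rw [this, map_neg, AlmostContact.η_φ, neg_zero]
  have h₃ : ∀ α β : Fin 3, β = α ∨ β = α + 1 ∨ β = α + 2 := by decide
  obtain rfl | rfl | rfl := h₃ α β
  · simp [(c _).η_ξ]
  · simp [h₂]
  · simp [h₁]

variable [RiemannianBundle (fun x : M ↦ TangentSpace (𝓡 m) x)]

theorem IsThreeQuasiSasakian.inner_ξ_ξ (h : IsThreeQuasiSasakian c) (α β : Fin 3) (x : M) :
    inner ℝ ((c α).ξ x) ((c β).ξ x) = if α = β then 1 else 0 := by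
  rw [(h.quasiSasakian α).compatible.inner_ξ, h.almostThreeContact.η_ξ]

/-- Evaluate `dΦ_α = 0` on `ξ_{α+1}, ξ_{α+2}, Z`. Contracting `Φ_α` with these Reeb fields gives `±
η_{α+2}` and `± η_{α+1}`, whose invariance along their own Reeb fields cancels all terms but this
one. -/
theorem IsThreeQuasiSasakian.inner_bracket_ξ_φ (h : IsThreeQuasiSasakian c) (α : Fin 3)
    (hZ : Z.DiffAt x) :
    inner ℝ (bracket (c (α + 1)).ξ (c (α + 2)).ξ x) ((c α).φ x (Z x)) = 0 := by
  have hq := h.quasiSasakian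
  have h₁ := (hq α).closed x _ _ Z (c (α + 1)).diffAt_ξ (c (α + 2)).diffAt_ξ hZ
  have e₁ : ∀ (W : VField m M) (y : M),
      (c α).fundamentalForm W (c (α + 1)).ξ y = (c (α + 2)).η y (W y) := fun W y ↦ by
    rw [AlmostContact.fundamentalForm, h.almostThreeContact.φ_ξ_succ, real_inner_comm,
      (hq _).compatible.inner_ξ]
  have e₂ : ∀ (W : VField m M) (y : M),
      (c α).fundamentalForm W (c (α + 2)).ξ y = -(c (α + 1)).η y (W y) := fun W y ↦ by
    rw [AlmostContact.fundamentalForm, h.almostThreeContact.φ_ξ_add_two, inner_neg_right,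
      real_inner_comm, (hq _).compatible.inner_ξ]
  have e₃ : (c α).fundamentalForm (c (α + 2)).ξ Z = fun y ↦ (c (α + 1)).η y (Z y) := by
    funext y
    rw [(hq α).compatible.fundamentalForm_swap, e₂, neg_neg]
  rw [dTwo, e₃, funext (e₁ Z), funext (e₂ (c (α + 1)).ξ)] at h₁
  simp only [AlmostContact.η_ξ, lieDeriv_const, e₁, e₂] at h₁
  rw [(hq (α + 1)).normal.lieDeriv_ξ_η hZ, (hq (α + 2)).normal.lieDeriv_ξ_η hZ,
    bracket_swap Z, map_neg, AlmostContact.fundamentalForm] at h₁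
  linarith

/-- `[ξ_α, ξ_β]` is proportional to `ξ_γ` for every even permutation `(α, β, γ)`. -/
theorem IsThreeQuasiSasakian.bracket_ξ_ξ (h : IsThreeQuasiSasakian c) (α : Fin 3) (x : M) :
    bracket (c (α + 1)).ξ (c (α + 2)).ξ x =
      (c α).η x (bracket (c (α + 1)).ξ (c (α + 2)).ξ x) • (c α).ξ x := by
  have h₁ : (c α).φ x (bracket (c (α + 1)).ξ (c (α + 2)).ξ x) = 0 := by
    refine ext_inner_right ℝ fun w ↦ ?_
    rw [(h.quasiSasakian α).compatible.inner_φ, inner_zero_left, neg_eq_zero]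
    simpa using h.inner_bracket_ξ_φ α
      (Z := FiberBundle.extend (EuclideanSpace ℝ (Fin m)) w)
      (FiberBundle.mdifferentiableAt_extend ..)
  -- The kernel of `φ_α` is spanned by `ξ_α`.
  have h₂ := (c α).φ_sq x (bracket (c (α + 1)).ξ (c (α + 2)).ξ x)
  rw [h₁, map_zero, eq_comm, neg_add_eq_zero] at h₂
  exact h₂

variable [IsContMDiffRiemannianBundle (𝓡 m) ∞ (EuclideanSpace ℝ (Fin m))
    (fun x : M ↦ TangentSpace (𝓡 m) x)]

/-- Differentiate `g(ξ_{α+1}, ξ_α) = 0` along the Killing field `ξ_{α+2}`. -/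
theorem IsThreeQuasiSasakian.η_bracket_ξ_ξ (h : IsThreeQuasiSasakian c) (α : Fin 3) (x : M) :
    (c α).η x (bracket (c (α + 1)).ξ (c (α + 2)).ξ x) =
      (c (α + 1)).η x (bracket (c (α + 2)).ξ (c α).ξ x) := by
  have h₁ := (h.quasiSasakian (α + 2)).lieDeriv_ξ_inner (x := x) (c (α + 1)).diffAt_ξ
    (c α).diffAt_ξ
  simp only [h.inner_ξ_ξ, lieDeriv_const] at h₁
  rw [bracket_swap, inner_neg_left, real_inner_comm ((c α).ξ x),
    (h.quasiSasakian α).compatible.inner_ξ, (h.quasiSasakian (α + 1)).compatible.inner_ξ] at h₁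
  linarith

/-- As `η_α(ξ_β)` is constant, the left side is the Lie derivative of `η_α = g(ξ_α, ·)` along `ξ_β`,
and the Killing property moves it onto `ξ_α`. -/
theorem IsThreeQuasiSasakian.two_mul_dOne_ξ (h : IsThreeQuasiSasakian c) (α β : Fin 3)
    (hZ : Z.DiffAt x) :
    2 * dOne (c α).η (c β).ξ Z x = inner ℝ (bracket (c β).ξ (c α).ξ x) (Z x) := by
  have h₁ := (h.quasiSasakian β).lieDeriv_ξ_inner (c α).diffAt_ξ hZ
  simp only [(h.quasiSasakian α).compatible.inner_ξ] at h₁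
  simp only [dOne, h.almostThreeContact.η_ξ, lieDeriv_const, h₁]
  ring

theorem IsThreeQuasiSasakian.sum_dOne_ξ_mul_η (h : IsThreeQuasiSasakian c) (β : Fin 3)
    (hY : Y.DiffAt x) (hZ : Z.DiffAt x) :
    ∑ α, (dOne (c α).η (c β).ξ Y x * (c α).η x (Z x)
      + dOne (c α).η (c β).ξ Z x * (c α).η x (Y x)) = 0 := by
  have h₁ : ∀ W : VField m M, W.DiffAt x → ∀ α, dOne (c α).η (c β).ξ W x =
      inner ℝ (bracket (c β).ξ (c α).ξ x) (W x) / 2 := fun W hW α ↦ by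
    rw [← h.two_mul_dOne_ξ α β hW]; ring
  simp only [h₁ Y hY, h₁ Z hZ]
  -- The three proportionality factors agree by the cyclic identity `η_bracket_ξ_ξ`. With one common
  -- `f` the sum becomes `f` times a cross-product expression plus its transpose.
  obtain ⟨f, h₀, h₂, h₃⟩ : ∃ f : ℝ, bracket (c 0).ξ (c 1).ξ x = f • (c 2).ξ x ∧
      bracket (c 1).ξ (c 2).ξ x = f • (c 0).ξ x ∧ bracket (c 2).ξ (c 0).ξ x = f • (c 1).ξ x := by
    have a₀ := h.bracket_ξ_ξ 0 x
    have a₁ := h.bracket_ξ_ξ 1 x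
    have a₂ := h.bracket_ξ_ξ 2 x
    have b₀ := h.η_bracket_ξ_ξ 0 x
    have b₁ := h.η_bracket_ξ_ξ 1 x
    simp only [Fin.isValue, zero_add, show (1 : Fin 3) + 1 = 2 from rfl,
      show (1 : Fin 3) + 2 = 0 from rfl, show (2 : Fin 3) + 1 = 0 from rfl,
      show (2 : Fin 3) + 2 = 1 from rfl] at a₀ a₁ a₂ b₀ b₁
    refine ⟨_, a₂, ?_, ?_⟩
    · rw [← b₁, ← b₀]; exact a₀
    · rw [← b₁]; exact a₁
  have hs : ∀ α, bracket (c α).ξ (c α).ξ x = 0 := fun α ↦ by simp [bracket]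
  have s₀ := bracket_swap (c 1).ξ (c 0).ξ x
  have s₁ := bracket_swap (c 2).ξ (c 1).ξ x
  have s₂ := bracket_swap (c 0).ξ (c 2).ξ x
  rw [h₀] at s₀
  rw [h₂] at s₁
  rw [h₃] at s₂
  fin_cases β <;>
  · simp only [Fin.sum_univ_three, Fin.isValue, Fin.zero_eta, Fin.mk_one, Fin.reduceFinMk, hs, h₀, h₂,
      h₃, s₀, s₁, s₂, inner_neg_left,
      inner_zero_left, real_inner_smul_left, (h.quasiSasakian _).compatible.inner_ξ]
    ring

end ThreeStructures

/-! ### The canonical connection: existence and uniqueness -/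

section CanonicalConnection

variable {m : ℕ} {M : Type*} [TopologicalSpace M]
  [ChartedSpace (EuclideanSpace ℝ (Fin m)) M] [IsManifold (𝓡 m) ∞ M]
  {c : Fin 3 → AlmostContact m M} {x : M} {X Y Z : VField m M}

/-- The torsion `2 ∑ dη_α ⊗ ξ_α` of the canonical connection. -/
def canonicalTorsion (c : Fin 3 → AlmostContact m M) (x : M) :
    TangentSpace (𝓡 m) x →L[ℝ] TangentSpace (𝓡 m) x →L[ℝ] TangentSpace (𝓡 m) x :=
  TensorialAt.mkHom₂ (I := 𝓡 m) (F := EuclideanSpace ℝ (Fin m)) (F' := EuclideanSpace ℝ (Fin m))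
    (V := fun x : M ↦ TangentSpace (𝓡 m) x) (V' := fun x : M ↦ TangentSpace (𝓡 m) x)
    (fun X Y ↦ (2 : ℝ) • ∑ α, dOne (c α).η X Y x • (c α).ξ x) x
    (fun Y _ ↦
      { smul := fun hf hX ↦ by
          simp only [((c _).tensorialAt_dOne_left Y).smul hf hX, smul_eq_mul, mul_smul,
            ← Finset.smul_sum, smul_comm (2 : ℝ)]
        add := fun hX hX' ↦ by
          simp only [((c _).tensorialAt_dOne_left Y).add hX hX', add_smul,
            Finset.sum_add_distrib, smul_add] })
    (fun X _ ↦
      { smul := fun hf hY ↦ by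
          simp only [((c _).tensorialAt_dOne_right X).smul hf hY, smul_eq_mul, mul_smul,
            ← Finset.smul_sum, smul_comm (2 : ℝ)]
        add := fun hY hY' ↦ by
          simp only [((c _).tensorialAt_dOne_right X).add hY hY', add_smul,
            Finset.sum_add_distrib, smul_add] })

theorem canonicalTorsion_apply (hX : X.DiffAt x) (hY : Y.DiffAt x) :
    canonicalTorsion c x (X x) (Y x) = (2 : ℝ) • ∑ α, dOne (c α).η X Y x • (c α).ξ x :=
  TensorialAt.mkHom₂_apply _ _ hX hY

theorem canonicalTorsion_swap (x : M) (v w : TangentSpace (𝓡 m) x) :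
    canonicalTorsion c x v w = -canonicalTorsion c x w v := by
  simp only [canonicalTorsion, TensorialAt.mkHom₂_apply_eq_extend, dOne_swap _
    (FiberBundle.extend (EuclideanSpace ℝ (Fin m)) v), neg_smul, Finset.sum_neg_distrib, smul_neg]

theorem contMDiffAt_canonicalTorsion
    (hX : ContMDiffAt (𝓡 m) (𝓡 m).tangent ∞ (fun y ↦ (⟨y, X y⟩ : TangentBundle (𝓡 m) M)) x)
    (hY : ContMDiffAt (𝓡 m) (𝓡 m).tangent ∞ (fun y ↦ (⟨y, Y y⟩ : TangentBundle (𝓡 m) M)) x) :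
    ContMDiffAt (𝓡 m) (𝓡 m).tangent ∞
      (fun y ↦ (⟨y, canonicalTorsion c y (X y) (Y y)⟩ : TangentBundle (𝓡 m) M)) x := by
  have h : ContMDiffAt (𝓡 m) (𝓡 m).tangent ∞ (fun y ↦ (⟨y, (2 : ℝ) • ∑ α,
      dOne (c α).η X Y y • (c α).ξ y⟩ : TangentBundle (𝓡 m) M)) x :=
    (contMDiffAt_const (c := (2 : ℝ))).smul_section (ContMDiffAt.sum_section fun α _ ↦
      ((c α).contMDiffAt_dOne hX hY).smul_section ((c α).smooth_ξ x))
  refine h.congr_of_eventuallyEq ?_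
  have hev : ∀ X : VField m M, ContMDiffAt (𝓡 m) (𝓡 m).tangent ∞
      (fun y ↦ (⟨y, X y⟩ : TangentBundle (𝓡 m) M)) x → ∀ᶠ y in nhds x, X.DiffAt y := fun X hX ↦
    ((contMDiffAt_iff_contMDiffAt_nhds (n := 1) (by simp)).1 (hX.of_le (by simp))).mono
      fun y hy ↦ hy.mdifferentiableAt one_ne_zero
  filter_upwards [hev X hX, hev Y hY] with y hXy hYy
  rw [canonicalTorsion_apply hXy hYy]

variable [RiemannianBundle (fun x : M ↦ TangentSpace (𝓡 m) x)]

theorem IsThreeQuasiSasakian.inner_canonicalTorsion (h : IsThreeQuasiSasakian c)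
    (hX : X.DiffAt x) (hY : Y.DiffAt x) (v : TangentSpace (𝓡 m) x) :
    inner ℝ (canonicalTorsion c x (X x) (Y x)) v =
      2 * ∑ α, dOne (c α).η X Y x * (c α).η x v := by
  simp only [canonicalTorsion_apply hX hY, real_inner_smul_left, sum_inner,
    (h.quasiSasakian _).compatible.inner_ξ]

variable [IsContMDiffRiemannianBundle (𝓡 m) ∞ (EuclideanSpace ℝ (Fin m))
    (fun x : M ↦ TangentSpace (𝓡 m) x)]

/-- The Killing property cancels the derivative along `ξ_β` with the brackets involving it. The
terms in `η_β` cancel because `η_β(T(X, Z)) = 2 dη_β(X, Z)`. The remaining torsion terms are `-2`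
times the sum in `sum_dOne_ξ_mul_η`. -/
theorem IsThreeQuasiSasakian.koszul_ξ (h : IsThreeQuasiSasakian c) (β : Fin 3)
    (hX : X.DiffAt x) (hZ : Z.DiffAt x) :
    koszul (canonicalTorsion c) X (c β).ξ Z x = 0 := by
  have hq := (h.quasiSasakian β).compatible
  have hξ := (c β).diffAt_ξ (x := x)
  have h₁ := (h.quasiSasakian β).lieDeriv_ξ_inner hX hZ
  have h₂ : (c β).η x (canonicalTorsion c x (X x) (Z x)) = 2 * dOne (c β).η X Z x := by
    simp [canonicalTorsion_apply hX hZ, h.almostThreeContact.η_ξ]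
  have h₃ := h.sum_dOne_ξ_mul_η β hX hZ
  have h₄ : dOne (c β).η X Z x = (lieDeriv X (fun y ↦ (c β).η y (Z y)) x
    - lieDeriv Z (fun y ↦ (c β).η y (X y)) x - (c β).η x (bracket X Z x)) / 2 := rfl
  have h₅ : bracket X (c β).ξ x = -bracket (c β).ξ X x := bracket_swap _ _ _
  simp only [lieDeriv, bracket] at h₁ h₄ h₅
  simp only [koszul, inner_add_left, h.inner_canonicalTorsion hX hξ,
    h.inner_canonicalTorsion hξ hZ, fun y ↦ real_inner_comm ((c β).ξ y) (X y),
    real_inner_comm ((c β).ξ x), hq.inner_ξ, h₁, h₅, dOne_swap _ X (c β).ξ]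
  simp only [Finset.sum_add_distrib] at h₃
  simp only [inner_neg_left, neg_mul, Finset.sum_neg_distrib, map_add, h₂, h₄]
  rw [real_inner_comm (X x)]
  linarith

theorem IsThreeQuasiSasakian.metricConnection_ξ (h : IsThreeQuasiSasakian c) (β : Fin 3) (x : M) :
    metricConnection (canonicalTorsion c) (c β).ξ x = 0 :=
  clm_ext_inner_vectorField fun X Z hX hZ ↦ by
    rw [metricConnection_apply, inner_metricCovDeriv hX (c β).diffAt_ξ hZ, h.koszul_ξ β hX hZ]
    simp

set_option synthInstance.maxHeartbeats 400000 in
theorem IsThreeQuasiSasakian.isCanonicalConnection (h : IsThreeQuasiSasakian c) :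
    IsCanonicalConnection c (metricConnection (canonicalTorsion c)) where
  smooth := metricConnection_contMDiff fun _ _ _ hX hY ↦ contMDiffAt_canonicalTorsion hX hY
  metric := metricConnection_isMetricCompatible canonicalTorsion_swap
  -- Metric compatibility applied to `η_α(Y) = g(ξ_α, Y)` with `ξ_α` parallel.
  parallel_η α x X Y hY := by
    have hq := (h.quasiSasakian α).compatible
    have := (metricConnection_isMetricCompatible
      (canonicalTorsion_swap (c := c))).mvfderiv_inner_eq X (c α).diffAt_ξ hY
    simp only [hq.inner_ξ, h.metricConnection_ξ, zero_apply, inner_zero_left, zero_add] at this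
    rw [lieDeriv, this, sub_self]
  parallel_ξ α x X := by simp [h.metricConnection_ξ]
  torsion_eq x X Y hX hY := by
    rw [metricConnection_torsion canonicalTorsion_swap, canonicalTorsion_apply hX hY]

theorem IsCanonicalConnection.torsion_eq_canonicalTorsion {cov : Connection m M}
    (h : IsCanonicalConnection c cov) : cov.torsion = canonicalTorsion c := by
  funext x
  ext1 v
  ext1 w
  have hv := FiberBundle.mdifferentiableAt_extend (𝓡 m) (EuclideanSpace ℝ (Fin m)) v
  have hw := FiberBundle.mdifferentiableAt_extend (𝓡 m) (EuclideanSpace ℝ (Fin m)) w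
  simpa using (h.torsion_eq x _ _ hv hw).trans (canonicalTorsion_apply hv hw).symm

theorem IsCanonicalConnection.apply_eq {cov cov' : Connection m M}
    (h : IsCanonicalConnection c cov) (h' : IsCanonicalConnection c cov') (hY : Y.DiffAt x) :
    cov' Y x = cov Y x :=
  clm_ext_inner_vectorField fun X Z hX hZ ↦ by
    rw [two_mul_inner_eq_koszul h.metric hX hY hZ, two_mul_inner_eq_koszul h'.metric hX hY hZ,
      h.torsion_eq_canonicalTorsion, h'.torsion_eq_canonicalTorsion]

end CanonicalConnection

end ThreeQS

end

/-- Uniqueness is asserted for `Y` differentiable at `x`: the axioms of a covariant derivative leave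
its values on other fields arbitrary. -/
theorem theorem2 (n m : ℕ) (hm : m = 4 * n + 3) (M : Type*) [TopologicalSpace M] [T2Space M]
    [SecondCountableTopology M]
    [ChartedSpace (EuclideanSpace ℝ (Fin m)) M]
    [IsManifold (𝓡 m) ∞ M]
    [RiemannianBundle (fun x : M ↦ TangentSpace (𝓡 m) x)]
    [IsContMDiffRiemannianBundle (𝓡 m) ∞ (EuclideanSpace ℝ (Fin m))
      (fun x : M ↦ TangentSpace (𝓡 m) x)]
    (c : Fin 3 → ThreeQS.AlmostContact m M)
    (hc : ThreeQS.IsThreeQuasiSasakian c) :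
    ∃ cov : ThreeQS.Connection m M, ThreeQS.IsCanonicalConnection c cov ∧
      ∀ cov' : ThreeQS.Connection m M, ThreeQS.IsCanonicalConnection c cov' →
        ∀ (x : M) (X Y : ThreeQS.VField m M), Y.DiffAt x →
          cov' Y x (X x) = cov Y x (X x) :=
  ⟨_, hc.isCanonicalConnection, fun _ h' _ _ _ hY ↦
    congr($(hc.isCanonicalConnection.apply_eq h' hY) _)⟩
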